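/- Let $\mathbb S^2=\{x\in\mathbb R^3:\|x\|_2=1\}$, $d(x,y)=\arccos\langle x,y\rangle$, $T_x\mathbb S^2=\{v\in\mathbb R^3:\langle x,v\rangle=0\}$, and $\exp_x v=\cos(\|v\|)\,x+\sin(\|v\|)\,v/\|v\|$ for $v\in T_x\mathbb S^2$ (with $\exp_x 0=x$). For every $x\in\mathbb S^2$ fix an arbitrary orthonormal basis $\eta_1^x,\eta_2^x$ of $T_x\mathbb S^2$ (no continuity in $x$ is required). For a smooth function $f$ on $\mathbb S^2$ and $i,j\in\{1,2\}$ let $$X_if(x)=\frac{d}{dt}\Big|_{t=0}f(\exp_x(t\eta_i^x)),\qquad X_iX_jf(x)=\frac{\partial^2}{\partial v_i\,\partial v_j}\Big|_{v=0}f\big(\exp_x(v_1\eta_1^x+v_2\eta_2^x)\big)$$ be its first and second derivatives in the centre of the normal coordinates at $x$. A superscript $x$ or $y$ at $X$ indicates the variable of a function of $(x,y)\in\mathbb S^2\times\mathbb S^2$ on which the operator acts, e.g. $X_j^xX_i^xX_k^yJ(x,y)=(X_jX_i\,g)(x)$ with $g(x')=(X_kJ(x',\cdot))(y)$. Let $N\ge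 0$ be an integer, $n=\lfloor N/2\rfloor$, and let $$\widetilde J_N(\omega)=\frac{1}{(n+1)^4}\,\frac{\sin^4((n+1)\omega/2)}{\sin^4(\omega/2)},$$ extended continuously to the zeros of $\sin(\omega/2)$. The Jackson kernel on $\mathbb S^2$ is $J_N(x,y)=\widetilde J_N(d(x,y))$. Theorem. The function $\widetilde J_N$ is $C^\infty$ on $\mathbb R$, and for all $x,y\in\mathbb S^2$ the function $(v,w)\mapsto J_N(\exp_xv,\exp_yw)$ is $C^\infty$ on $T_x\mathbb S^2\times T_y\mathbb S^2$; in particular all derivatives below exist. For all $x\neq y$ in $\mathbb S^2$ and all $i,j,k\in\{1,2\}$, $$|J_N(x,y)|\le\frac{\pi^4}{(n+1)^4d(x,y)^4},\qquad |X_k^yJ_N(x,y)|\le\frac{3\pi^4}{(n+1)^3d(x,y)^4},$$ $$|X_i^xX_k^yJ_N(x,y)|\le\frac{16.5\,\pi^4}{(n+1)^2d(x,y)^4},\qquad |X_i^xX_k^xJ_N(x,y)|\le\frac{16.5\,\pi^4}{(n+1)^2d(x,y)^4},$$ $$|X_j^xX_i^xX_k^yJ_N(x,y)|\le\frac{101\,\pi^4}{(n+1)\,d(x,y)^4}.$$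 On the diagonal, for all $x\in\mathbb S^2$ and all $i,j,k\in\{1,2\}$, with the same basis $\eta_1^x,\eta_2^x$ used in both variables, $$J_N(x,x)=1,\qquad X_i^xX_i^yJ_N(x,x)=-X_i^xX_i^xJ_N(x,x)=-\widetilde J_N''(0),$$ $$X_k^yJ_N(x,x)=0,\qquad X_i^xX_k^yJ_N(x,x)=X_i^xX_k^xJ_N(x,x)=0\ \text{ if } i\ne k,$$ $$X_j^xX_i^xX_k^yJ_N(x,x)=X_j^xX_i^yX_k^yJ_N(x,x)=0.$$ -/

import Mathlib

open scoped ContDiff Topology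

noncomputable section

namespace SphereJackson

/-- Euclidean three-space. -/
abbrev E3 : Type := EuclideanSpace ℝ (Fin 3)

/-- The unit sphere `S² ⊆ ℝ³`. -/
abbrev S2 : Type := Metric.sphere (0 : E3) 1

/-- The tangent plane `T_x S² = {v | ⟨x, v⟩ = 0}`. -/
abbrev TangentPlane (x : S2) : Submodule ℝ E3 := (Submodule.span ℝ {(x : E3)})ᗮ

/-- The geodesic distance `d(x, y) = arccos ⟨x, y⟩`. -/
def geoDist (x y : S2) : ℝ := Real.arccos (inner ℝ (x : E3) (y : E3))

theorem norm_exp_eq_one (x : S2) (v : TangentPlane x) :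
    ‖Real.cos ‖v‖ • (x : E3) + (Real.sin ‖v‖ / ‖v‖) • (v : E3)‖ = 1 := by
  have hx : ‖(x : E3)‖ = 1 := by simp
  have hv : inner ℝ (x : E3) (v : E3) = 0 :=
    Submodule.mem_orthogonal_singleton_iff_inner_right.1 v.2
  have h : ‖Real.cos ‖v‖ • (x : E3) + (Real.sin ‖v‖ / ‖v‖) • (v : E3)‖ ^ 2 = 1 := by
    rw [norm_add_sq_real, inner_smul_left, inner_smul_right, hv, norm_smul, norm_smul, hx]
    by_cases h0 : ‖v‖ = 0
    · have h0' : v = 0 := by simpa using h0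
      subst h0'
      simp
    · have h1 : ‖Real.sin ‖v‖ / ‖v‖‖ * ‖(v : E3)‖ = ‖Real.sin ‖v‖‖ := by
        rw [norm_div, norm_norm]
        exact div_mul_cancel₀ _ h0
      rw [h1]
      simp only [Real.norm_eq_abs, mul_one, sq_abs, mul_zero, add_zero]
      exact Real.cos_sq_add_sin_sq _
  have hnn := norm_nonneg (Real.cos ‖v‖ • (x : E3) + (Real.sin ‖v‖ / ‖v‖) • (v : E3))
  nlinarith

/-- The exponential map `exp_x v = cos ‖v‖ x + sin ‖v‖ v / ‖v‖`, with `exp_x 0 = x`. -/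
def sphereExp (x : S2) (v : TangentPlane x) : S2 :=
  ⟨Real.cos ‖v‖ • (x : E3) + (Real.sin ‖v‖ / ‖v‖) • (v : E3), by
    simpa using norm_exp_eq_one x v⟩

/-- A choice of an orthonormal basis `η₁ˣ, η₂ˣ` of each tangent plane. -/
abbrev Frame : Type := ∀ x : S2, OrthonormalBasis (Fin 2) ℝ (TangentPlane x)

/-- `(X_i f)(x)`, the derivative of `f` at `x` along the geodesic in direction `η_iˣ`. -/
def X (η : Frame) (i : Fin 2) (f : S2 → ℝ) (x : S2) : ℝ :=
  deriv (fun t : ℝ => f (sphereExp x (t • η x i))) 0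

/-- `(X_i X_j f)(x)`, the second partial derivative `∂²/∂v_i ∂v_j` at `v = 0` of
`f (exp_x (v₁ η₁ˣ + v₂ η₂ˣ))`, that is, an entry of the Hessian of `f` in the centre of
normal coordinates. -/
def XX (η : Frame) (i j : Fin 2) (f : S2 → ℝ) (x : S2) : ℝ :=
  deriv (fun s : ℝ => deriv (fun t : ℝ => f (sphereExp x (s • η x i + t • η x j))) 0) 0

/-- The trigonometric polynomial `J̃_N`, the continuous extension of
`w ↦ sin⁴((n + 1) w / 2) / ((n + 1)⁴ sin⁴(w / 2))`, `n = ⌊N / 2⌋`, to the zeros of the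
denominator. -/
def jacksonTrig (N : ℕ) : ℝ → ℝ :=
  extendFrom {w : ℝ | Real.sin (w / 2) ≠ 0} fun w =>
    1 / (((N / 2 : ℕ) : ℝ) + 1) ^ 4 *
      (Real.sin ((((N / 2 : ℕ) : ℝ) + 1) * w / 2) ^ 4 / Real.sin (w / 2) ^ 4)

/-- The Jackson kernel `J_N(x, y) = J̃_N(d(x, y))` on the sphere. -/
def jacksonKernel (N : ℕ) (x y : S2) : ℝ := jacksonTrig N (geoDist x y)

/-- `X_kʸ J(x, y)`. -/
def dY (η : Frame) (J : S2 → S2 → ℝ) (k : Fin 2) (x y : S2) : ℝ :=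
  X η k (fun y' => J x y') y

/-- `X_iˣ X_kʸ J(x, y)`. -/
def dXdY (η : Frame) (J : S2 → S2 → ℝ) (i k : Fin 2) (x y : S2) : ℝ :=
  X η i (fun x' => X η k (fun y' => J x' y') y) x

/-- `X_iˣ X_kˣ J(x, y)`. -/
def dXdX (η : Frame) (J : S2 → S2 → ℝ) (i k : Fin 2) (x y : S2) : ℝ :=
  XX η i k (fun x' => J x' y) x

/-- `X_jˣ X_iˣ X_kʸ J(x, y)`. -/
def dXdXdY (η : Frame) (J : S2 → S2 → ℝ) (j i k : Fin 2) (x y : S2) : ℝ :=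
  XX η j i (fun x' => X η k (fun y' => J x' y') y) x

/-- `X_jˣ X_iʸ X_kʸ J(x, y)`. -/
def dXdYdY (η : Frame) (J : S2 → S2 → ℝ) (j i k : Fin 2) (x y : S2) : ℝ :=
  X η j (fun x' => XX η i k (fun y' => J x' y') y) x

end SphereJackson

end

/-!
Put `m = n + 1`. Since `(1 - cos (m θ)) / (1 - cos θ) = (sin (m θ / 2) / sin (θ / 2)) ^ 2` and
`cos (m θ) = T_m (cos θ)`, the polynomial `R = (1 - T_m) / (1 - X)` satisfies
`J̃_N θ = P (cos θ)` with `P = R ^ 2 / m ^ 4` (`jacksonTrig_eq`), so the kernel is the polynomial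
`P ⟨x, y⟩` in the ambient coordinates (`jacksonKernel_eq`). This removes the singularities at
coinciding and at antipodal points. Smoothness follows because `cos ‖v‖` and `sin ‖v‖ / ‖v‖` are
entire functions of `‖v‖ ^ 2` (`cosSqrt`, `sincSqrt`).

For a function `F` on `ℝ³`, `X_i F (x)` is the ambient derivative along `η_i` (`X_comp_coe`) and
`X_i X_j F (x) = D²F(x)(η_i, η_j) - δ_ij DF(x) x` (`XX_comp_coe`). Hence every derivative of the
kernel is an explicit combination of `P'`, `P''`, `P'''` at `p = ⟨x, y⟩` with products of the
numbers `⟨y, η_i^x⟩`, `⟨x, η_k^y⟩` and `⟨η_i^x, η_k^y⟩`. The first two kinds vanish for `x = y`,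
which gives the values on the diagonal.

Off the diagonal they are at most `q = √(1 - p ^ 2)` in absolute value, by Bessel's inequality, and
the third kind is at most `1`. So it is enough to bound `q P'`, `P'`, `q P''`, `q ^ 2 P''` and
`q ^ 3 P'''` by constants times `m ^ k / (m ^ 4 (1 - p) ^ 2)`, with `k = 1, 2, 3, 2, 3`
respectively. Write `V = 1 - T_m`. The derivatives of `P = V ^ 2 / (m ^ 4 (1 - p) ^ 2)` are
polynomials in `V`, `V'`, `V''`, `V'''`, `R` over `m ^ 4 (1 - p) ^ 2`, up to one more power of
`1 - p` in `P'''` that is cancelled by `q ^ 2 = (1 - p) (1 + p)`.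
The bounds follow by the triangle inequality from `0 ≤ V ≤ 2`, `0 ≤ R ≤ m ^ 2`, `|V'| ≤ m ^ 2`,
`|q V'| ≤ m`, `|q R| ≤ 2 m`, `|q V''| ≤ m ^ 3` and Chebyshev's differential equation
(`FejerData`). Finally `1 - cos θ ≥ 2 θ ^ 2 / π ^ 2` (`le_div_geoDist`).
-/

noncomputable section

namespace SphereJackson

section Polynomials

open Polynomial Polynomial.Chebyshev

/-! ### Bounds for Chebyshev polynomials -/

theorem exists_angle {p q : ℝ} (hq : 0 ≤ q) (hpq : q ^ 2 = 1 - p ^ 2) :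
    ∃ θ : ℝ, Real.cos θ = p ∧ Real.sin θ = q := by
  refine ⟨Real.arccos p, Real.cos_arccos (by nlinarith) (by nlinarith), ?_⟩
  rw [Real.sin_arccos, ← hpq, Real.sqrt_sq hq]

/-- Pell's equation for Chebyshev polynomials, i.e. `cos ^ 2 + sin ^ 2 = 1` at the angle
`(n + 1) θ`. -/
theorem chebyshev_pell (n : ℤ) {p q : ℝ} (hq : 0 ≤ q) (hpq : q ^ 2 = 1 - p ^ 2) :
    (T ℝ (n + 1)).eval p ^ 2 + (q * (U ℝ n).eval p) ^ 2 = 1 := by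
  obtain ⟨θ, rfl, rfl⟩ := exists_angle hq hpq
  rw [T_real_cos, mul_comm (Real.sin θ), U_real_cos]
  push_cast
  exact Real.cos_sq_add_sin_sq _

theorem abs_eval_U_le (n : ℕ) {p : ℝ} (hp : |p| ≤ 1) : |(U ℝ n).eval p| ≤ n + 1 := by
  induction n with
  | zero => simp
  | succ n ih =>
    have h1 := abs_eval_T_real_le_one (n + 1) hp
    push_cast
    rw [U_eq_X_mul_U_add_T, eval_add, eval_mul, eval_X]
    have h2 := abs_add_le (p * (U ℝ n).eval p) ((T ℝ (n + 1)).eval p)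
    have h3 : |p * (U ℝ n).eval p| ≤ n + 1 := by
      rw [abs_mul]
      exact (mul_le_of_le_one_left (abs_nonneg _) hp).trans ih
    linarith

theorem abs_mul_eval_U_le_one (n : ℤ) {p q : ℝ} (hq : 0 ≤ q) (hpq : q ^ 2 = 1 - p ^ 2) :
    |q * (U ℝ n).eval p| ≤ 1 := by
  have := chebyshev_pell n hq hpq
  exact abs_le_one_iff_mul_self_le_one.2 (by nlinarith [sq_nonneg ((T ℝ (n + 1)).eval p)])

/-- In terms of `p = cos θ`, `q = sin θ`, this bounds the `θ`-derivative of `sin (m θ) / sin θ`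
by `m ^ 2`, where `m = n + 1`. -/
theorem abs_mul_eval_derivative_U_le (n : ℕ) {p q : ℝ} (hq : 0 ≤ q) (hpq : q ^ 2 = 1 - p ^ 2) :
    |q * (derivative (U ℝ n)).eval p| ≤ ((n : ℝ) + 1) ^ 2 := by
  have hp : |p| ≤ 1 := abs_le_one_iff_mul_self_le_one.2 (by nlinarith)
  induction n with
  | zero => simp
  | succ n ih =>
    have h1 := abs_mul_eval_U_le_one n hq hpq
    have h4 : q * (derivative (U ℝ ((n + 1 : ℕ) : ℤ))).eval p =
        p * (q * (derivative (U ℝ n)).eval p) + (n + 2) * (q * (U ℝ n).eval p) := by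
      push_cast
      rw [U_eq_X_mul_U_add_T, derivative_add, derivative_mul, T_derivative_eq_U]
      simp
      ring
    have h3 : |p * (q * (derivative (U ℝ n)).eval p)| ≤ ((n : ℝ) + 1) ^ 2 := by
      rw [abs_mul]
      exact (mul_le_of_le_one_left (abs_nonneg _) hp).trans ih
    have h5 : |((n : ℝ) + 2) * (q * (U ℝ n).eval p)| ≤ n + 2 := by
      rw [abs_mul, abs_of_nonneg (by positivity : (0 : ℝ) ≤ n + 2)]
      exact mul_le_of_le_one_right (by positivity) h1
    rw [h4]
    refine (abs_add_le _ _).trans ((add_le_add h3 h5).trans ?_)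
    push_cast
    have : (0 : ℝ) ≤ n := n.cast_nonneg
    nlinarith

/-- In terms of `p = cos θ` this is `|sin (m θ / 2)| ≤ m |sin (θ / 2)|`. -/
theorem one_sub_eval_T_le (n : ℕ) {p : ℝ} (hp : |p| ≤ 1) :
    1 - (T ℝ (n + 1)).eval p ≤ ((n : ℝ) + 1) ^ 2 * (1 - p) := by
  obtain ⟨h1, h2⟩ := abs_le.1 hp
  obtain ⟨θ, rfl⟩ : ∃ θ : ℝ, Real.cos (2 * θ) = p :=
    ⟨Real.arccos p / 2, by rw [mul_div_cancel₀ _ two_ne_zero, Real.cos_arccos h1 h2]⟩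
  have h3 := U_real_cos θ n
  have h4 := abs_eval_U_le n (Real.abs_cos_le_one θ)
  have h5 : (U ℝ n).eval (Real.cos θ) ^ 2 ≤ ((n : ℝ) + 1) ^ 2 :=
    sq_le_sq' (abs_le.1 h4).1 (abs_le.1 h4).2
  rw [T_real_cos]
  push_cast at h3 ⊢
  rw [show ((n : ℝ) + 1) * (2 * θ) = 2 * (((n : ℝ) + 1) * θ) by ring, Real.cos_two_mul,
    Real.cos_sq', ← h3, Real.cos_two_mul, Real.cos_sq' θ]
  nlinarith [mul_le_mul_of_nonneg_right h5 (sq_nonneg (Real.sin θ))]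

/-! ### The Fejér and Jackson polynomials -/

/-- The polynomial `R` with `(1 - X) R = 1 - T_m`; in terms of `p = cos θ` its value is
`(sin (m θ / 2) / sin (θ / 2)) ^ 2`, that is, `m` times the Fejér kernel. -/
def fejerPoly (m : ℕ) : ℝ[X] := (T ℝ m - 1) /ₘ (Polynomial.X - C 1)

theorem one_sub_X_mul_fejerPoly (m : ℕ) : (1 - Polynomial.X) * fejerPoly m = 1 - T ℝ m := by
  have h : (Polynomial.X - C 1) * fejerPoly m = T ℝ m - 1 :=
    mul_divByMonic_eq_iff_isRoot.2 (by simp)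
  rw [C_1] at h
  linear_combination -h

/-- The polynomial `P` with `J̃_N θ = P (cos θ)` and hence `J_N(x, y) = P ⟨x, y⟩`, for
`m = ⌊N / 2⌋ + 1`. -/
def jacksonPoly (m : ℕ) : ℝ[X] := C (((m : ℝ) ^ 4)⁻¹) * fejerPoly m ^ 2

theorem one_sub_mul_eval_fejerPoly (m : ℕ) (p : ℝ) :
    (1 - p) * (fejerPoly m).eval p = 1 - (T ℝ m).eval p := by
  simpa using congrArg (eval p) (one_sub_X_mul_fejerPoly m)

theorem one_sub_mul_eval_derivative_fejerPoly (m : ℕ) (p : ℝ) :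
    (1 - p) * (derivative (fejerPoly m)).eval p =
      -(derivative (T ℝ m)).eval p + (fejerPoly m).eval p := by
  have h := congrArg (fun r : ℝ[X] => (derivative r).eval p) (one_sub_X_mul_fejerPoly m)
  simp [derivative_mul] at h
  linear_combination h

theorem one_sub_mul_eval_derivative2_fejerPoly (m : ℕ) (p : ℝ) :
    (1 - p) * (derivative (derivative (fejerPoly m))).eval p =
      -(derivative (derivative (T ℝ m))).eval p + 2 * (derivative (fejerPoly m)).eval p := by
  have h := congrArg (fun r : ℝ[X] => (derivative (derivative r)).eval p)
    (one_sub_X_mul_fejerPoly m)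
  simp [derivative_mul] at h
  linear_combination h

theorem one_sub_mul_eval_derivative3_fejerPoly (m : ℕ) (p : ℝ) :
    (1 - p) * (derivative (derivative (derivative (fejerPoly m)))).eval p =
      -(derivative (derivative (derivative (T ℝ m)))).eval p +
        3 * (derivative (derivative (fejerPoly m))).eval p := by
  have h := congrArg (fun r : ℝ[X] => (derivative (derivative (derivative r))).eval p)
    (one_sub_X_mul_fejerPoly m)
  simp [derivative_mul] at h
  linear_combination h

theorem eval_jacksonPoly_one {m : ℕ} (hm : m ≠ 0) : (jacksonPoly m).eval 1 = 1 := by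
  have h := one_sub_mul_eval_derivative_fejerPoly m 1
  rw [T_derivative_eq_U] at h
  simp at h
  have h' : (fejerPoly m).eval 1 = (m : ℝ) ^ 2 := by linear_combination -h
  have : (m : ℝ) ≠ 0 := by exact_mod_cast hm
  simp [jacksonPoly, h']
  field_simp

/-! ### Estimates for the quotient `(1 - T_m) / (1 - X)` -/

theorem abs_mul_le_mul {a b c d : ℝ} (h : |a| ≤ c) (h' : |b| ≤ d) : |a * b| ≤ c * d := by
  rw [abs_mul]
  exact mul_le_mul h h' (abs_nonneg _) ((abs_nonneg _).trans h)

/-- The values at `p = cos θ` of `V = 1 - T_m`, its first three derivatives and the quotient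
`R = V / (1 - p)`, together with `q = sin θ`, abstracted to the relations that the estimates of
the Jackson kernel use. -/
structure FejerData (m p q V V1 V2 V3 R : ℝ) : Prop where
  one_le : 1 ≤ m
  abs_p_le : |p| ≤ 1
  q_nonneg : 0 ≤ q
  q_sq : q ^ 2 = 1 - p ^ 2
  V_nonneg : 0 ≤ V
  V_le : V ≤ 2
  V_eq : (1 - p) * R = V
  R_nonneg : 0 ≤ R
  R_le : R ≤ m ^ 2
  abs_V1_le : |V1| ≤ m ^ 2
  V1_mul_q_sq : (V1 * q) ^ 2 = m ^ 2 * (V * (2 - V))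
  abs_V2_mul_q_le : |V2 * q| ≤ m ^ 3
  ode2 : V2 * q ^ 2 = m ^ 2 * (1 - V) + p * V1
  ode3 : V3 * q ^ 2 = 3 * p * V2 - (m ^ 2 - 1) * V1

namespace FejerData

variable {m p q V V1 V2 V3 R : ℝ}

theorem abs_V1_mul_q_le (h : FejerData m p q V V1 V2 V3 R) : |V1 * q| ≤ m := by
  refine abs_le_of_sq_le_sq ?_ (by linarith [h.one_le])
  rw [h.V1_mul_q_sq]
  exact mul_le_of_le_one_right (sq_nonneg _) (by nlinarith [sq_nonneg (V - 1)])

theorem abs_R_mul_q_le (h : FejerData m p q V V1 V2 V3 R) : |R * q| ≤ 2 * m := by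
  refine abs_le_of_sq_le_sq ?_ (by linarith [h.one_le])
  obtain ⟨h1, h2⟩ := abs_le.1 h.abs_p_le
  have e : (R * q) ^ 2 = R * (V * (1 + p)) := by
    rw [mul_pow, h.q_sq, ← h.V_eq]; ring
  have h3 : V * (1 + p) ≤ 2 * 2 :=
    mul_le_mul h.V_le (by linarith) (by linarith) (by norm_num)
  have h4 : R * (V * (1 + p)) ≤ m ^ 2 * (2 * 2) :=
    mul_le_mul h.R_le h3 (mul_nonneg h.V_nonneg (by linarith)) (sq_nonneg _)
  rw [e]
  linarith

theorem abs_V_le (h : FejerData m p q V V1 V2 V3 R) : |V| ≤ 2 := by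
  rw [abs_of_nonneg h.V_nonneg]; exact h.V_le

theorem abs_R_le (h : FejerData m p q V V1 V2 V3 R) : |R| ≤ m ^ 2 := by
  rw [abs_of_nonneg h.R_nonneg]; exact h.R_le

theorem first_bound (h : FejerData m p q V V1 V2 V3 R) :
    |q * (2 * V * V1 + 2 * V * R)| ≤ 12 * m := by
  have a1 := abs_le.1 (abs_mul_le_mul h.abs_V_le h.abs_V1_mul_q_le)
  have a2 := abs_le.1 (abs_mul_le_mul h.abs_V_le h.abs_R_mul_q_le)
  exact abs_le.2 ⟨by linarith, by linarith⟩

theorem first_bound' (h : FejerData m p q V V1 V2 V3 R) :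
    |2 * V * V1 + 2 * V * R| ≤ 8 * m ^ 2 := by
  have a1 := abs_le.1 (abs_mul_le_mul h.abs_V_le h.abs_V1_le)
  have a2 := abs_le.1 (abs_mul_le_mul h.abs_V_le h.abs_R_le)
  exact abs_le.2 ⟨by linarith, by linarith⟩

theorem second_bound (h : FejerData m p q V V1 V2 V3 R) :
    |q * (2 * (V1 ^ 2 + V * V2) + 8 * R * V1 + 6 * R ^ 2)| ≤ 26 * m ^ 3 := by
  have a1 := abs_le.1 (abs_mul_le_mul h.abs_V1_le h.abs_V1_mul_q_le)
  have a2 := abs_le.1 (abs_mul_le_mul h.abs_V_le h.abs_V2_mul_q_le)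
  have a3 := abs_le.1 (abs_mul_le_mul h.abs_R_le h.abs_V1_mul_q_le)
  have a4 := abs_le.1 (abs_mul_le_mul h.abs_R_le h.abs_R_mul_q_le)
  exact abs_le.2 ⟨by linarith, by linarith⟩

/-- The differential equation eliminates `V2`, and the terms of order `m ^ 2 V` combine to
`m ^ 2 (6 V - 4 V ^ 2)`. -/
theorem second_bound' (h : FejerData m p q V V1 V2 V3 R) :
    |q ^ 2 * (2 * (V1 ^ 2 + V * V2) + 8 * R * V1 + 6 * R ^ 2)| ≤ 48 * m ^ 2 := by
  have a2 := abs_le.1 (abs_mul_le_mul h.abs_V_le (abs_mul_le_mul h.abs_p_le h.abs_V1_le))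
  have a3 := abs_le.1 (abs_mul_le_mul h.abs_R_mul_q_le h.abs_V1_mul_q_le)
  have a4 := abs_le.1 (abs_mul_le_mul h.abs_R_mul_q_le h.abs_R_mul_q_le)
  have b1 : m ^ 2 * (6 * V - 4 * V ^ 2) ≤ m ^ 2 * 4 :=
    mul_le_mul_of_nonneg_left (by nlinarith [sq_nonneg (V - 1)]) (sq_nonneg _)
  have b2 : m ^ 2 * (-4) ≤ m ^ 2 * (6 * V - 4 * V ^ 2) :=
    mul_le_mul_of_nonneg_left (by nlinarith [h.V_nonneg, h.V_le]) (sq_nonneg _)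
  have e : q ^ 2 * (2 * (V1 ^ 2 + V * V2) + 8 * R * V1 + 6 * R ^ 2) =
      m ^ 2 * (6 * V - 4 * V ^ 2) + 2 * (V * (p * V1)) + 8 * (R * q * (V1 * q)) +
        6 * (R * q * (R * q)) := by
    linear_combination 2 * h.V1_mul_q_sq + 2 * V * h.ode2
  rw [e]
  exact abs_le.2 ⟨by linarith, by linarith⟩

theorem third_bound (h : FejerData m p q V V1 V2 V3 R) :
    |6 * V1 * V2 * q ^ 3 + 2 * V * V3 * q ^ 3 +
      (1 + p) * q * (12 * (V1 ^ 2 + V * V2) + 36 * R * V1 + 24 * R ^ 2)| ≤ 268 * m ^ 3 := by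
  obtain ⟨h1, h2⟩ := abs_le.1 h.abs_p_le
  have hm := h.one_le
  have a1 : |V2 * q ^ 2| ≤ 2 * m ^ 2 := by
    have b1 := abs_le.1 (abs_mul_le_mul h.abs_p_le h.abs_V1_le)
    have b2 : |1 - V| ≤ 1 := abs_le.2 ⟨by linarith [h.V_le], by linarith [h.V_nonneg]⟩
    have b3 := abs_le.1 (abs_mul_le_mul (le_of_eq (abs_of_nonneg (sq_nonneg m))) b2)
    rw [h.ode2]
    exact abs_le.2 ⟨by linarith, by linarith⟩
  have a2 : |V3 * q ^ 3| ≤ 4 * m ^ 3 := by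
    have b1 := abs_le.1 (abs_mul_le_mul h.abs_p_le h.abs_V2_mul_q_le)
    have b2 : |m ^ 2 - 1| ≤ m ^ 2 := abs_le.2 ⟨by nlinarith, by linarith⟩
    have b3 := abs_le.1 (abs_mul_le_mul b2 h.abs_V1_mul_q_le)
    have e : V3 * q ^ 3 = 3 * (p * (V2 * q)) - (m ^ 2 - 1) * (V1 * q) := by
      linear_combination q * h.ode3
    rw [e]
    exact abs_le.2 ⟨by linarith, by linarith⟩
  have a3 := abs_le.1 (abs_mul_le_mul h.abs_V1_mul_q_le a1)
  have a4 := abs_le.1 (abs_mul_le_mul h.abs_V_le a2)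
  have c1 := abs_le.1 (abs_mul_le_mul h.abs_V1_le h.abs_V1_mul_q_le)
  have c2 := abs_le.1 (abs_mul_le_mul h.abs_V_le h.abs_V2_mul_q_le)
  have c3 := abs_le.1 (abs_mul_le_mul h.abs_R_le h.abs_V1_mul_q_le)
  have c4 := abs_le.1 (abs_mul_le_mul h.abs_R_le h.abs_R_mul_q_le)
  have c5 : |q * (12 * (V1 ^ 2 + V * V2) + 36 * R * V1 + 24 * R ^ 2)| ≤ 120 * m ^ 3 :=
    abs_le.2 ⟨by linarith, by linarith⟩
  have c6 : |1 + p| ≤ 2 := abs_le.2 ⟨by linarith, by linarith⟩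
  have c7 := abs_le.1 (abs_mul_le_mul c6 c5)
  exact abs_le.2 ⟨by linarith, by linarith⟩

end FejerData

theorem fejerData (n : ℕ) {p q : ℝ} (hq : 0 ≤ q) (hpq : q ^ 2 = 1 - p ^ 2) (hp : p < 1) :
    FejerData ((n : ℝ) + 1) p q (1 - (T ℝ ((n + 1 : ℕ) : ℤ)).eval p)
      (-(derivative (T ℝ ((n + 1 : ℕ) : ℤ))).eval p)
      (-(derivative (derivative (T ℝ ((n + 1 : ℕ) : ℤ)))).eval p)
      (-(derivative (derivative (derivative (T ℝ ((n + 1 : ℕ) : ℤ))))).eval p)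
      ((fejerPoly (n + 1)).eval p) := by
  have hp' : |p| ≤ 1 := abs_le_one_iff_mul_self_le_one.2 (by nlinarith)
  have hT := abs_le.1 (abs_eval_T_real_le_one ((n + 1 : ℕ) : ℤ) hp')
  have hV := one_sub_mul_eval_fejerPoly (n + 1) p
  have hd : derivative (T ℝ ((n + 1 : ℕ) : ℤ)) = ((n : ℝ[X]) + 1) * U ℝ n := by
    rw [T_derivative_eq_U]; simp
  have hd2 : derivative (derivative (T ℝ ((n + 1 : ℕ) : ℤ))) =
      ((n : ℝ[X]) + 1) * derivative (U ℝ n) := by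
    rw [hd]; simp [derivative_mul]
  have hn : (0 : ℝ) ≤ n := n.cast_nonneg
  have hn' : |(n : ℝ) + 1| ≤ n + 1 := (abs_of_nonneg (by positivity)).le
  constructor
  · linarith
  · exact hp'
  · exact hq
  · exact hpq
  · linarith
  · linarith
  · exact hV
  · exact nonneg_of_mul_nonneg_right (by rw [hV]; linarith) (sub_pos.2 hp)
  · have := one_sub_eval_T_le n hp'
    refine le_of_mul_le_mul_left ?_ (sub_pos.2 hp)
    rw [hV]
    push_cast
    linarith
  · rw [hd, abs_neg]
    have := abs_mul_le_mul hn' (abs_eval_U_le n hp')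
    simp only [eval_mul, eval_add, eval_natCast, eval_one]
    linarith
  · have := chebyshev_pell n hq hpq
    rw [hd]
    push_cast
    simp
    linear_combination ((n : ℝ) + 1) ^ 2 * this
  · rw [hd2]
    have := abs_mul_le_mul hn' (abs_mul_eval_derivative_U_le n hq hpq)
    simp only [eval_mul, eval_add, eval_natCast, eval_one]
    rw [neg_mul, abs_neg, show ((n : ℝ) + 1) * eval p (derivative (U ℝ n)) * q =
      (n + 1) * (q * eval p (derivative (U ℝ n))) by ring]
    linarith
  -- Chebyshev's differential equation
  · have := one_sub_X_sq_mul_iterate_derivative_T_eval ((n + 1 : ℕ) : ℤ) 0 p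
    simp at this
    rw [hpq]
    push_cast
    linear_combination -this
  -- its derivative
  · have := one_sub_X_sq_mul_iterate_derivative_T_eval ((n + 1 : ℕ) : ℤ) 1 p
    simp at this
    rw [hpq]
    push_cast
    linear_combination -this

/-! ### Estimates for the derivatives of the Jackson polynomial -/

theorem eval_jacksonPoly_mul (n : ℕ) (p : ℝ) :
    (jacksonPoly (n + 1)).eval p * (((n : ℝ) + 1) ^ 4 * (1 - p) ^ 2) =
      (1 - (T ℝ ((n + 1 : ℕ) : ℤ)).eval p) ^ 2 := by
  have hm : (n : ℝ) + 1 ≠ 0 := by positivity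
  rw [← one_sub_mul_eval_fejerPoly]
  simp [jacksonPoly]
  field_simp

theorem eval_derivative_jacksonPoly (n : ℕ) (p : ℝ) :
    (derivative (jacksonPoly (n + 1))).eval p * ((n : ℝ) + 1) ^ 4 =
      2 * (fejerPoly (n + 1)).eval p * (derivative (fejerPoly (n + 1))).eval p := by
  have hm : (n : ℝ) + 1 ≠ 0 := by positivity
  simp [jacksonPoly, derivative_mul, pow_two]
  field_simp
  ring

theorem eval_derivative2_jacksonPoly (n : ℕ) (p : ℝ) :
    (derivative (derivative (jacksonPoly (n + 1)))).eval p * ((n : ℝ) + 1) ^ 4 =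
      2 * ((derivative (fejerPoly (n + 1))).eval p ^ 2 +
        (fejerPoly (n + 1)).eval p * (derivative (derivative (fejerPoly (n + 1)))).eval p) := by
  have hm : (n : ℝ) + 1 ≠ 0 := by positivity
  simp [jacksonPoly, derivative_mul, pow_two]
  field_simp
  ring

theorem eval_derivative3_jacksonPoly (n : ℕ) (p : ℝ) :
    (derivative (derivative (derivative (jacksonPoly (n + 1))))).eval p * ((n : ℝ) + 1) ^ 4 =
      6 * (derivative (fejerPoly (n + 1))).eval p *
          (derivative (derivative (fejerPoly (n + 1)))).eval p +
        2 * (fejerPoly (n + 1)).eval p *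
          (derivative (derivative (derivative (fejerPoly (n + 1))))).eval p := by
  have hm : (n : ℝ) + 1 ≠ 0 := by positivity
  simp [jacksonPoly, derivative_mul, pow_two]
  field_simp
  ring

theorem abs_le_of_mul_eq {a b c d : ℝ} (hd : 0 ≤ d) (h : a * d = b) (hb : |b| ≤ c) :
    |a| * d ≤ c := by
  rw [← abs_of_nonneg hd, ← abs_mul, h]
  exact hb

section JacksonPolyBounds

variable (n : ℕ) {p q : ℝ}

theorem abs_eval_jacksonPoly_le (hp : |p| ≤ 1) :
    |(jacksonPoly (n + 1)).eval p| * (((n : ℝ) + 1) ^ 4 * (1 - p) ^ 2) ≤ 4 := by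
  have hT := abs_le.1 (abs_eval_T_real_le_one ((n + 1 : ℕ) : ℤ) hp)
  refine abs_le_of_mul_eq (by positivity) (eval_jacksonPoly_mul n p) ?_
  rw [abs_of_nonneg (sq_nonneg _)]
  nlinarith

theorem abs_mul_eval_derivative_jacksonPoly_le (hq : 0 ≤ q) (hpq : q ^ 2 = 1 - p ^ 2)
    (hp : p < 1) :
    |q * (derivative (jacksonPoly (n + 1))).eval p| * (((n : ℝ) + 1) ^ 4 * (1 - p) ^ 2) ≤
      12 * ((n : ℝ) + 1) := by
  have h := fejerData n hq hpq hp
  refine abs_le_of_mul_eq (by positivity) ?_ h.first_bound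
  have e0 := one_sub_mul_eval_fejerPoly (n + 1) p
  have e1 := one_sub_mul_eval_derivative_fejerPoly (n + 1) p
  have d1 := eval_derivative_jacksonPoly n p
  rw [← e0]
  generalize (fejerPoly (n + 1)).eval p = R at *
  generalize (derivative (fejerPoly (n + 1))).eval p = R1 at *
  linear_combination q * (1 - p) ^ 2 * d1 + q * (1 - p) * 2 * R * e1

theorem abs_eval_derivative_jacksonPoly_le (hq : 0 ≤ q) (hpq : q ^ 2 = 1 - p ^ 2)
    (hp : p < 1) :
    |(derivative (jacksonPoly (n + 1))).eval p| * (((n : ℝ) + 1) ^ 4 * (1 - p) ^ 2) ≤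
      8 * ((n : ℝ) + 1) ^ 2 := by
  have h := fejerData n hq hpq hp
  refine abs_le_of_mul_eq (by positivity) ?_ h.first_bound'
  have e0 := one_sub_mul_eval_fejerPoly (n + 1) p
  have e1 := one_sub_mul_eval_derivative_fejerPoly (n + 1) p
  have d1 := eval_derivative_jacksonPoly n p
  rw [← e0]
  generalize (fejerPoly (n + 1)).eval p = R at *
  generalize (derivative (fejerPoly (n + 1))).eval p = R1 at *
  linear_combination (1 - p) ^ 2 * d1 + (1 - p) * 2 * R * e1

/-- The second derivative of `P = R ^ 2 / m ^ 4`, with `R = V / (1 - p)` differentiated as a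
quotient. -/
theorem eval_derivative2_jacksonPoly_mul (n : ℕ) (p : ℝ) :
    (derivative (derivative (jacksonPoly (n + 1)))).eval p * (((n : ℝ) + 1) ^ 4 * (1 - p) ^ 2) =
      2 * ((-(derivative (T ℝ ((n + 1 : ℕ) : ℤ))).eval p) ^ 2 +
        (1 - (T ℝ ((n + 1 : ℕ) : ℤ)).eval p) *
          -(derivative (derivative (T ℝ ((n + 1 : ℕ) : ℤ)))).eval p) +
      8 * (fejerPoly (n + 1)).eval p * -(derivative (T ℝ ((n + 1 : ℕ) : ℤ))).eval p +
      6 * (fejerPoly (n + 1)).eval p ^ 2 := by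
  have e0 := one_sub_mul_eval_fejerPoly (n + 1) p
  have e1 := one_sub_mul_eval_derivative_fejerPoly (n + 1) p
  have e2 := one_sub_mul_eval_derivative2_fejerPoly (n + 1) p
  have d1 := eval_derivative2_jacksonPoly n p
  rw [← e0]
  generalize (fejerPoly (n + 1)).eval p = R at *
  generalize (derivative (fejerPoly (n + 1))).eval p = R1 at *
  generalize (derivative (derivative (fejerPoly (n + 1)))).eval p = R2 at *
  generalize -(derivative (T ℝ ((n + 1 : ℕ) : ℤ))).eval p = V1 at *
  linear_combination (1 - p) ^ 2 * d1 + (2 * ((1 - p) * R1 + V1 + R) + 4 * R) * e1 +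
    2 * R * (1 - p) * e2

theorem abs_mul_eval_derivative2_jacksonPoly_le (hq : 0 ≤ q) (hpq : q ^ 2 = 1 - p ^ 2)
    (hp : p < 1) :
    |q * (derivative (derivative (jacksonPoly (n + 1)))).eval p| *
      (((n : ℝ) + 1) ^ 4 * (1 - p) ^ 2) ≤ 26 * ((n : ℝ) + 1) ^ 3 := by
  have h := fejerData n hq hpq hp
  refine abs_le_of_mul_eq (by positivity) ?_ h.second_bound
  rw [mul_assoc, eval_derivative2_jacksonPoly_mul]

theorem abs_sq_mul_eval_derivative2_jacksonPoly_le (hq : 0 ≤ q) (hpq : q ^ 2 = 1 - p ^ 2)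
    (hp : p < 1) :
    |q ^ 2 * (derivative (derivative (jacksonPoly (n + 1)))).eval p| *
      (((n : ℝ) + 1) ^ 4 * (1 - p) ^ 2) ≤ 48 * ((n : ℝ) + 1) ^ 2 := by
  have h := fejerData n hq hpq hp
  refine abs_le_of_mul_eq (by positivity) ?_ h.second_bound'
  rw [mul_assoc, eval_derivative2_jacksonPoly_mul]

theorem abs_cube_mul_eval_derivative3_jacksonPoly_le (hq : 0 ≤ q) (hpq : q ^ 2 = 1 - p ^ 2)
    (hp : p < 1) :
    |q ^ 3 * (derivative (derivative (derivative (jacksonPoly (n + 1))))).eval p| *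
      (((n : ℝ) + 1) ^ 4 * (1 - p) ^ 2) ≤ 268 * ((n : ℝ) + 1) ^ 3 := by
  have h := fejerData n hq hpq hp
  refine abs_le_of_mul_eq (by positivity) ?_ h.third_bound
  have e0 := one_sub_mul_eval_fejerPoly (n + 1) p
  have e1 := one_sub_mul_eval_derivative_fejerPoly (n + 1) p
  have e2 := one_sub_mul_eval_derivative2_fejerPoly (n + 1) p
  have e3 := one_sub_mul_eval_derivative3_fejerPoly (n + 1) p
  have d1 := eval_derivative3_jacksonPoly n p
  rw [← e0]
  generalize (fejerPoly (n + 1)).eval p = R at *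
  generalize (derivative (fejerPoly (n + 1))).eval p = R1 at *
  generalize (derivative (derivative (fejerPoly (n + 1)))).eval p = R2 at *
  generalize (derivative (derivative (derivative (fejerPoly (n + 1))))).eval p = R3 at *
  generalize -(derivative (T ℝ ((n + 1 : ℕ) : ℤ))).eval p = V1 at *
  generalize -(derivative (derivative (T ℝ ((n + 1 : ℕ) : ℤ)))).eval p = V2 at *
  generalize -(derivative (derivative (derivative (T ℝ ((n + 1 : ℕ) : ℤ))))).eval p = V3 at *
  -- `q ^ 2 / (1 - p) = 1 + p` absorbs one power of the small denominator `1 - p`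
  have f1 : q ^ 2 * R1 = (1 + p) * (V1 + R) := by rw [hpq]; linear_combination (1 + p) * e1
  have f2 : q ^ 2 * R2 = (1 + p) * (V2 + 2 * R1) := by rw [hpq]; linear_combination (1 + p) * e2
  have g : (6 * R1 * R2 + 2 * R * R3) * (1 - p) ^ 2 =
      6 * (V1 + R) * (V2 + 2 * R1) + 2 * R * (1 - p) * V3 + 6 * R * (V2 + 2 * R1) := by
    linear_combination 6 * (1 - p) * R2 * e1 + 6 * (V1 + R) * e2 + 2 * R * (1 - p) * e3 +
      6 * R * e2
  have g2 : q ^ 2 * V2 * R = (1 + p) * ((1 - p) * R) * V2 := by rw [hpq]; ring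
  linear_combination q ^ 3 * (1 - p) ^ 2 * d1 + q ^ 3 * g + 12 * q * (V1 + 2 * R) * f1 +
    12 * q * g2

end JacksonPolyBounds

end Polynomials

/-! ### `cos √u` and `sin √u / √u` as smooth functions -/

open Filter in
theorem contDiff_ofScalarsSum {c : ℕ → ℝ} (hc : ∀ k, c k ≠ 0)
    (h : ∀ k, ‖c (k + 1)‖ / ‖c k‖ ≤ 1 / ((k : ℝ) + 1)) :
    ContDiff ℝ ∞ (FormalMultilinearSeries.ofScalarsSum c : ℝ → ℝ) := by
  have hr : (FormalMultilinearSeries.ofScalars ℝ c).radius = ⊤ :=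
    FormalMultilinearSeries.ofScalars_radius_eq_top_of_tendsto ℝ c (Eventually.of_forall hc)
      (squeeze_zero (fun k => by positivity) h tendsto_one_div_add_atTop_nhds_zero_nat)
  have h1 := (FormalMultilinearSeries.ofScalars ℝ c).hasFPowerSeriesOnBall (by simp [hr])
  rw [hr] at h1
  refine contDiff_iff_contDiffAt.2 fun z => ?_
  exact (h1.analyticAt_of_mem (by simp)).contDiffAt

/-- The entire function with `cosSqrt (u ^ 2) = cos u`. -/
def cosSqrt : ℝ → ℝ :=
  FormalMultilinearSeries.ofScalarsSum fun k : ℕ => (-1 : ℝ) ^ k / (2 * k).factorial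

/-- The entire function with `sincSqrt (u ^ 2) = sin u / u`. -/
def sincSqrt : ℝ → ℝ :=
  FormalMultilinearSeries.ofScalarsSum fun k : ℕ => (-1 : ℝ) ^ k / (2 * k + 1).factorial

theorem cosSqrt_sq (u : ℝ) : cosSqrt (u ^ 2) = Real.cos u := by
  rw [cosSqrt, FormalMultilinearSeries.ofScalars_sum_eq]
  rw [← (Real.hasSum_cos u).tsum_eq]
  refine tsum_congr fun k => ?_
  rw [pow_mul, smul_eq_mul]
  ring

theorem sincSqrt_sq_mul (u : ℝ) : sincSqrt (u ^ 2) * u = Real.sin u := by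
  rw [sincSqrt, FormalMultilinearSeries.ofScalars_sum_eq, ← tsum_mul_right]
  rw [← (Real.hasSum_sin u).tsum_eq]
  refine tsum_congr fun k => ?_
  rw [pow_succ u (2 * k), pow_mul, smul_eq_mul]
  ring

theorem cosSqrt_zero : cosSqrt 0 = 1 := by
  simpa using cosSqrt_sq 0

theorem sincSqrt_zero : sincSqrt 0 = 1 := by
  simp [sincSqrt]

theorem contDiff_cosSqrt : ContDiff ℝ ∞ cosSqrt := by
  refine contDiff_ofScalarsSum (fun k => by positivity) fun k => ?_
  simp only [norm_div, norm_pow, norm_neg, norm_one, one_pow, RCLike.norm_natCast]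
  rw [show 2 * (k + 1) = 2 * k + 1 + 1 by ring, Nat.factorial_succ, Nat.factorial_succ]
  push_cast
  have : (0 : ℝ) < (2 * k).factorial := by positivity
  rw [div_div, div_le_div_iff₀ (by positivity) (by positivity)]
  field_simp
  nlinarith [(k.cast_nonneg : (0 : ℝ) ≤ k)]

theorem contDiff_sincSqrt : ContDiff ℝ ∞ sincSqrt := by
  refine contDiff_ofScalarsSum (fun k => by positivity) fun k => ?_
  simp only [norm_div, norm_pow, norm_neg, norm_one, one_pow, RCLike.norm_natCast]
  rw [show 2 * (k + 1) + 1 = 2 * k + 1 + 1 + 1 by ring, Nat.factorial_succ (2 * k + 1 + 1),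
    Nat.factorial_succ (2 * k + 1)]
  push_cast
  have : (0 : ℝ) < (2 * k + 1).factorial := by positivity
  rw [div_div, div_le_div_iff₀ (by positivity) (by positivity)]
  field_simp
  nlinarith [(k.cast_nonneg : (0 : ℝ) ≤ k)]

theorem hasDerivAt_cosSqrt (u : ℝ) : HasDerivAt cosSqrt (deriv cosSqrt u) u :=
  ((contDiff_cosSqrt.differentiable (by simp)) u).hasDerivAt

theorem hasDerivAt_sincSqrt (u : ℝ) : HasDerivAt sincSqrt (deriv sincSqrt u) u :=
  ((contDiff_sincSqrt.differentiable (by simp)) u).hasDerivAt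

theorem differentiable_deriv_cosSqrt : Differentiable ℝ (deriv cosSqrt) :=
  (contDiff_infty_iff_deriv.1 contDiff_cosSqrt).2.differentiable (by simp)

theorem differentiable_deriv_sincSqrt : Differentiable ℝ (deriv sincSqrt) :=
  (contDiff_infty_iff_deriv.1 contDiff_sincSqrt).2.differentiable (by simp)

/-- Obtained by differentiating `cosSqrt (u ^ 2) = cos u` twice at `u = 0`. -/
theorem deriv_cosSqrt_zero : deriv cosSqrt 0 = -1 / 2 := by
  have h1 : (fun u : ℝ => deriv cosSqrt (u ^ 2) * (2 * u)) = fun u => -Real.sin u := by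
    ext u
    have h2 : HasDerivAt (fun u : ℝ => cosSqrt (u ^ 2)) (deriv cosSqrt (u ^ 2) * (2 * u)) u :=
      ((hasDerivAt_cosSqrt (u ^ 2)).comp u (hasDerivAt_pow 2 u)).congr_deriv (by simp)
    simp only [cosSqrt_sq] at h2
    exact h2.unique (Real.hasDerivAt_cos u)
  have h3 : HasDerivAt (fun u : ℝ => deriv cosSqrt (u ^ 2) * (2 * u)) (2 * deriv cosSqrt 0) 0 := by
    have h4 : DifferentiableAt ℝ (fun u : ℝ => deriv cosSqrt (u ^ 2)) 0 :=
      (differentiable_deriv_cosSqrt.comp (differentiable_pow 2)) 0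
    exact (h4.hasDerivAt.mul ((hasDerivAt_id (0 : ℝ)).const_mul 2)).congr_deriv
      (by simp [mul_comm])
  rw [h1] at h3
  have := h3.unique (Real.hasDerivAt_sin 0).neg
  simp at this
  linarith

/-! ### The exponential map and the operators `X_i`, `X_i X_j` in ambient coordinates -/

theorem coe_sphereExp (x : S2) (v : TangentPlane x) :
    (sphereExp x v : E3) = cosSqrt (‖v‖ ^ 2) • (x : E3) + sincSqrt (‖v‖ ^ 2) • (v : E3) := by
  rcases eq_or_ne v 0 with rfl | hv
  · simp [sphereExp, cosSqrt_zero]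
  · have : ‖v‖ ≠ 0 := norm_ne_zero_iff.2 hv
    rw [cosSqrt_sq, eq_div_of_mul_eq this (sincSqrt_sq_mul ‖v‖)]
    rfl

theorem contDiff_coe_sphereExp (x : S2) :
    ContDiff ℝ ∞ fun v : TangentPlane x => (sphereExp x v : E3) := by
  simp only [coe_sphereExp]
  have h : ContDiff ℝ ∞ fun v : TangentPlane x => ‖v‖ ^ 2 := contDiff_norm_sq ℝ
  exact ((contDiff_cosSqrt.comp h).smul contDiff_const).add
    ((contDiff_sincSqrt.comp h).smul (TangentPlane x).subtypeL.contDiff)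

theorem inner_frame (η : Frame) (x : S2) (i j : Fin 2) :
    inner ℝ (η x i : E3) (η x j : E3) = if i = j then (1 : ℝ) else 0 := by
  rw [← Submodule.coe_inner, (η x).inner_eq_ite]

theorem inner_base_frame (η : Frame) (x : S2) (i : Fin 2) :
    inner ℝ (x : E3) (η x i : E3) = 0 :=
  Submodule.mem_orthogonal_singleton_iff_inner_right.1 (η x i).2

theorem norm_sq_combination (η : Frame) (x : S2) (i j : Fin 2) (s t : ℝ) :
    ‖s • η x i + t • η x j‖ ^ 2 =
      s ^ 2 + 2 * (if i = j then 1 else 0) * s * t + t ^ 2 := by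
  rw [norm_add_sq_real, norm_smul, norm_smul, inner_smul_left, inner_smul_right,
    (η x).inner_eq_ite, (η x).norm_eq_one, (η x).norm_eq_one]
  simp
  split_ifs <;> ring

/-- `X_i` is the derivative in the ambient space in the direction `η_i`. -/
theorem X_comp_coe (η : Frame) (i : Fin 2) (x : S2) {F : E3 → ℝ} {F' : E3 →L[ℝ] ℝ}
    (hF : HasFDerivAt F F' x) : X η i (fun x' => F x') x = F' (η x i) := by
  have h2 : ∀ t : ℝ, (sphereExp x (t • η x i) : E3) =
      Real.cos t • (x : E3) + Real.sin t • (η x i : E3) := by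
    intro t
    rw [coe_sphereExp, norm_smul, (η x).norm_eq_one, mul_one, Real.norm_eq_abs, sq_abs,
      cosSqrt_sq, Submodule.coe_smul, smul_smul, sincSqrt_sq_mul]
  have h : HasDerivAt (fun t : ℝ => (sphereExp x (t • η x i) : E3)) (η x i : E3) 0 := by
    simp only [h2]
    exact (((Real.hasDerivAt_cos 0).smul_const (x : E3)).add
      ((Real.hasDerivAt_sin 0).smul_const (η x i : E3))).congr_deriv (by simp)
  refine HasDerivAt.deriv (f := fun t : ℝ => F (sphereExp x (t • η x i))) ?_
  refine HasFDerivAt.comp_hasDerivAt (0 : ℝ) ?_ h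
  rw [h2]
  simpa using hF

section GeodesicVariation

variable {E : Type*} [NormedAddCommGroup E] [NormedSpace ℝ E] (a b c : E) (δ : ℝ)

/-- The derivative at `t = 0` of `exp_a (s b + t c)`, for unit vectors `b`, `c` orthogonal to `a`
with `⟨b, c⟩ = δ`. -/
def geodesicVariation (s : ℝ) : E :=
  (deriv cosSqrt (s ^ 2) * (2 * δ * s)) • a +
    (sincSqrt (s ^ 2) • c + (deriv sincSqrt (s ^ 2) * (2 * δ * s)) • (s • b))

theorem hasDerivAt_geodesic_family (s : ℝ) :
    HasDerivAt (fun t : ℝ => cosSqrt (s ^ 2 + 2 * δ * s * t + t ^ 2) • a +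
      sincSqrt (s ^ 2 + 2 * δ * s * t + t ^ 2) • (s • b + t • c))
      (geodesicVariation a b c δ s) 0 := by
  have hq : HasDerivAt (fun t : ℝ => s ^ 2 + 2 * δ * s * t + t ^ 2) (2 * δ * s) 0 :=
    ((((hasDerivAt_id (0 : ℝ)).const_mul (2 * δ * s)).const_add (s ^ 2)).add
      (hasDerivAt_pow 2 (0 : ℝ))).congr_deriv (by simp)
  have hq0 : s ^ 2 = s ^ 2 + 2 * δ * s * 0 + 0 ^ 2 := by ring
  have hl : HasDerivAt (fun t : ℝ => s • b + t • c) c 0 :=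
    (((hasDerivAt_id (0 : ℝ)).smul_const c).const_add (s • b)).congr_deriv (by simp)
  have hC := (hasDerivAt_cosSqrt (s ^ 2)).comp_of_eq (0 : ℝ) hq hq0
  have hS := (hasDerivAt_sincSqrt (s ^ 2)).comp_of_eq (0 : ℝ) hq hq0
  exact ((hC.smul_const a).add (hS.smul hl)).congr_deriv (by simp [geodesicVariation])

theorem hasDerivAt_geodesic :
    HasDerivAt (fun s : ℝ => cosSqrt (s ^ 2) • a + (sincSqrt (s ^ 2) * s) • b) b 0 := by
  simp only [cosSqrt_sq, sincSqrt_sq_mul]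
  exact (((Real.hasDerivAt_cos 0).smul_const a).add
    ((Real.hasDerivAt_sin 0).smul_const b)).congr_deriv (by simp)

theorem hasDerivAt_geodesicVariation :
    HasDerivAt (geodesicVariation a b c δ) ((-δ) • a) 0 := by
  have hsq : HasDerivAt (fun s : ℝ => s ^ 2) 0 0 :=
    (hasDerivAt_pow 2 (0 : ℝ)).congr_deriv (by simp)
  have h0 : (0 : ℝ) = 0 ^ 2 := by simp
  have hS := ((hasDerivAt_sincSqrt 0).comp_of_eq (0 : ℝ) hsq h0).congr_deriv (mul_zero _)
  have d0 : HasDerivAt (fun s : ℝ => 2 * δ * s) (2 * δ) 0 :=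
    ((hasDerivAt_id (0 : ℝ)).const_mul (2 * δ)).congr_deriv (mul_one _)
  have d1 := ((differentiable_deriv_cosSqrt 0).hasDerivAt.comp_of_eq (0 : ℝ) hsq h0).mul d0
  have d2 := ((differentiable_deriv_sincSqrt 0).hasDerivAt.comp_of_eq (0 : ℝ) hsq h0).mul d0
  have d3 := (hasDerivAt_id (0 : ℝ)).smul_const b
  refine ((d1.smul_const a).add ((hS.smul_const c).add (d2.smul d3))).congr_deriv ?_
  simp [deriv_cosSqrt_zero]
  rw [← neg_smul]
  congr 1
  ring

theorem geodesicVariation_zero : geodesicVariation a b c δ 0 = c := by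
  simp [geodesicVariation, sincSqrt_zero]

end GeodesicVariation

/-- `X_i X_j` is the Hessian in the ambient space, corrected by the derivative in the direction
of the normal `x`, because geodesics have acceleration `-x`. -/
theorem XX_comp_coe (η : Frame) (i j : Fin 2) (x : S2) {F : E3 → ℝ} {F' : E3 → E3 →L[ℝ] ℝ}
    {F'' : E3 →L[ℝ] E3 →L[ℝ] ℝ} (hF : ∀ z, HasFDerivAt F (F' z) z) (hF' : HasFDerivAt F' F'' x) :
    XX η i j (fun x' => F x') x =
      F'' (η x i) (η x j) - (if i = j then 1 else 0) * F' x x := by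
  set δ : ℝ := if i = j then 1 else 0 with hδ
  have hexp : ∀ s t : ℝ, (sphereExp x (s • η x i + t • η x j) : E3) =
      cosSqrt (s ^ 2 + 2 * δ * s * t + t ^ 2) • (x : E3) +
        sincSqrt (s ^ 2 + 2 * δ * s * t + t ^ 2) • (s • (η x i : E3) + t • (η x j : E3)) := by
    intro s t
    rw [coe_sphereExp, norm_sq_combination]
    rfl
  have hinner : ∀ s : ℝ, deriv (fun t : ℝ => F (sphereExp x (s • η x i + t • η x j))) 0 =
      F' (cosSqrt (s ^ 2) • (x : E3) + (sincSqrt (s ^ 2) * s) • (η x i : E3))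
        (geodesicVariation (x : E3) (η x i) (η x j) δ s) := by
    intro s
    simp only [hexp]
    refine HasDerivAt.deriv ?_
    refine (hF _).comp_hasDerivAt_of_eq (0 : ℝ)
      (hasDerivAt_geodesic_family (x : E3) (η x i) (η x j) δ s) ?_
    simp [smul_smul]
  have hF'' := hF'.comp_hasDerivAt_of_eq (0 : ℝ) (hasDerivAt_geodesic (x : E3) (η x i))
    (by simp [cosSqrt_zero])
  have hmain := hF''.clm_apply (hasDerivAt_geodesicVariation (x : E3) (η x i) (η x j) δ)
  rw [XX]
  simp only [hinner]
  refine hmain.deriv.trans ?_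
  simp [geodesicVariation_zero, cosSqrt_zero]
  ring

section Kernel

open Polynomial Polynomial.Chebyshev

/-! ### The Jackson kernel as a polynomial in the inner product -/

theorem dense_sin_half_ne_zero : Dense {w : ℝ | Real.sin (w / 2) ≠ 0} := by
  have h : {w : ℝ | Real.sin (w / 2) ≠ 0} = (Set.range fun k : ℤ => 2 * (k * Real.pi))ᶜ := by
    ext w
    simp only [Set.mem_ofPred_eq, Set.mem_compl_iff, Set.mem_range, ne_eq, Real.sin_eq_zero_iff,
      not_iff_not]
    exact exists_congr fun k => ⟨fun hk => by linarith, fun hk => by linarith⟩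
  rw [h]
  exact (Set.countable_range _).dense_compl ℝ

theorem jacksonTrig_eq (N : ℕ) (w : ℝ) :
    jacksonTrig N w = (jacksonPoly (N / 2 + 1)).eval (Real.cos w) := by
  have hc : Continuous fun w : ℝ => (jacksonPoly (N / 2 + 1)).eval (Real.cos w) :=
    (jacksonPoly (N / 2 + 1)).continuous.comp Real.continuous_cos
  refine extendFrom_eq (dense_sin_half_ne_zero w) ?_
  refine (hc.continuousAt.tendsto.mono_left nhdsWithin_le_nhds).congr' ?_
  filter_upwards [self_mem_nhdsWithin] with v (hv : Real.sin (v / 2) ≠ 0)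
  have half_angle : ∀ u : ℝ, 1 - Real.cos u = 2 * Real.sin (u / 2) ^ 2 := fun u => by
    have h1 := Real.cos_two_mul (u / 2)
    have h2 := Real.cos_sq' (u / 2)
    rw [mul_div_cancel₀ _ (two_ne_zero (α := ℝ))] at h1
    linarith
  have h := eval_jacksonPoly_mul (N / 2) (Real.cos v)
  rw [T_real_cos, half_angle, half_angle] at h
  simp only [Nat.cast_add, Nat.cast_one, Int.cast_add, Int.cast_one, Int.cast_natCast] at h
  have hm : ((N / 2 : ℕ) : ℝ) + 1 ≠ 0 := by positivity
  field_simp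
  linear_combination h / 4

theorem contDiff_jacksonTrig (N : ℕ) : ContDiff ℝ ∞ (jacksonTrig N) := by
  rw [funext (jacksonTrig_eq N)]
  exact ((jacksonPoly (N / 2 + 1)).contDiff_aeval ∞).comp Real.contDiff_cos

theorem iteratedDeriv_two_jacksonTrig_zero (N : ℕ) :
    iteratedDeriv 2 (jacksonTrig N) 0 = -(derivative (jacksonPoly (N / 2 + 1))).eval 1 := by
  have h1 : deriv (jacksonTrig N) =
      fun w => (derivative (jacksonPoly (N / 2 + 1))).eval (Real.cos w) * -Real.sin w := by
    rw [funext (jacksonTrig_eq N)]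
    ext w
    exact (((jacksonPoly (N / 2 + 1)).hasDerivAt _).comp w (Real.hasDerivAt_cos w)).deriv
  rw [iteratedDeriv_succ, iteratedDeriv_one, h1]
  have h2 := (((derivative (jacksonPoly (N / 2 + 1))).hasDerivAt _).comp 0
    (Real.hasDerivAt_cos 0)).mul (Real.hasDerivAt_sin 0).neg
  refine h2.deriv.trans ?_
  simp

theorem abs_inner_le_one (x y : S2) : |inner ℝ (x : E3) (y : E3)| ≤ 1 := by
  simpa using abs_real_inner_le_norm (x : E3) (y : E3)

theorem inner_lt_one {x y : S2} (hxy : x ≠ y) : inner ℝ (x : E3) (y : E3) < 1 :=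
  lt_of_le_of_ne (abs_le.1 (abs_inner_le_one x y)).2 fun he =>
    hxy (Subtype.ext ((inner_eq_one_iff_of_norm_eq_one (by simp) (by simp)).1 he))

theorem cos_geoDist (x y : S2) : Real.cos (geoDist x y) = inner ℝ (x : E3) (y : E3) := by
  have h := abs_le.1 (abs_inner_le_one x y)
  exact Real.cos_arccos h.1 h.2

theorem jacksonKernel_eq (N : ℕ) (x y : S2) :
    jacksonKernel N x y = (jacksonPoly (N / 2 + 1)).eval (inner ℝ (x : E3) (y : E3)) := by
  rw [jacksonKernel, jacksonTrig_eq, cos_geoDist]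

theorem contDiff_jacksonKernel_sphereExp (N : ℕ) (x y : S2) :
    ContDiff ℝ ∞ (fun p : TangentPlane x × TangentPlane y =>
      jacksonKernel N (sphereExp x p.1) (sphereExp y p.2)) := by
  simp only [jacksonKernel_eq]
  exact ((jacksonPoly (N / 2 + 1)).contDiff_aeval ∞).comp
    (((contDiff_coe_sphereExp x).comp contDiff_fst).inner ℝ
      ((contDiff_coe_sphereExp y).comp contDiff_snd))

/-! ### Derivatives of zonal functions -/

section Derivatives

variable (G : ℝ[X]) (a b : E3)

theorem hasFDerivAt_eval_inner (z : E3) :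
    HasFDerivAt (fun z : E3 => G.eval (inner ℝ a z))
      ((derivative G).eval (inner ℝ a z) • innerSL ℝ a) z :=
  (G.hasDerivAt _).comp_hasFDerivAt z (innerSL ℝ a).hasFDerivAt

theorem hasFDerivAt_inner (z : E3) : HasFDerivAt (fun z : E3 => inner ℝ b z) (innerSL ℝ b) z :=
  (innerSL ℝ b).hasFDerivAt

theorem hasFDerivAt_eval_inner_mul (z : E3) :
    HasFDerivAt (fun z : E3 => G.eval (inner ℝ a z) * inner ℝ b z)
      (G.eval (inner ℝ a z) • innerSL ℝ b +
        inner ℝ b z • (derivative G).eval (inner ℝ a z) • innerSL ℝ a) z :=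
  (hasFDerivAt_eval_inner G a z).mul (hasFDerivAt_inner b z)

variable (η : Frame) (x : S2)

theorem X_eval_inner (i : Fin 2) :
    X η i (fun x' => G.eval (inner ℝ a (x' : E3))) x =
      (derivative G).eval (inner ℝ a (x : E3)) * inner ℝ a (η x i : E3) := by
  rw [X_comp_coe η i x (hasFDerivAt_eval_inner G a x)]
  simp

theorem X_eval_inner_mul (i : Fin 2) :
    X η i (fun x' => G.eval (inner ℝ a (x' : E3)) * inner ℝ b (x' : E3)) x =
      (derivative G).eval (inner ℝ a (x : E3)) * inner ℝ a (η x i : E3) * inner ℝ b (x : E3) +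
        G.eval (inner ℝ a (x : E3)) * inner ℝ b (η x i : E3) := by
  rw [X_comp_coe η i x (hasFDerivAt_eval_inner_mul G a b x)]
  simp
  ring

theorem XX_eval_inner (i j : Fin 2) :
    XX η i j (fun x' => G.eval (inner ℝ a (x' : E3))) x =
      (derivative (derivative G)).eval (inner ℝ a (x : E3)) *
          inner ℝ a (η x i : E3) * inner ℝ a (η x j : E3) -
        (if i = j then 1 else 0) *
          ((derivative G).eval (inner ℝ a (x : E3)) * inner ℝ a (x : E3)) := by
  rw [XX_comp_coe η i j x (hasFDerivAt_eval_inner G a)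
    ((hasFDerivAt_eval_inner (derivative G) a x).smul_const (innerSL ℝ a))]
  simp

theorem XX_eval_inner_mul (i j : Fin 2) :
    XX η i j (fun x' => G.eval (inner ℝ a (x' : E3)) * inner ℝ b (x' : E3)) x =
      (derivative (derivative G)).eval (inner ℝ a (x : E3)) *
          inner ℝ a (η x i : E3) * inner ℝ a (η x j : E3) * inner ℝ b (x : E3) +
        (derivative G).eval (inner ℝ a (x : E3)) *
          (inner ℝ a (η x i : E3) * inner ℝ b (η x j : E3) +
            inner ℝ a (η x j : E3) * inner ℝ b (η x i : E3)) -
        (if i = j then 1 else 0) *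
          ((derivative G).eval (inner ℝ a (x : E3)) * inner ℝ a (x : E3) * inner ℝ b (x : E3) +
            G.eval (inner ℝ a (x : E3)) * inner ℝ b (x : E3)) := by
  have h := ((hasFDerivAt_eval_inner G a x).smul_const (innerSL ℝ b)).add
    ((hasFDerivAt_inner b x).smul
      ((hasFDerivAt_eval_inner (derivative G) a x).smul_const (innerSL ℝ a)))
  rw [XX_comp_coe η i j x (hasFDerivAt_eval_inner_mul G a b) h]
  split_ifs <;> simp <;> ring

end Derivatives

/-! ### Derivatives of the Jackson kernel -/

section KernelDerivatives

variable (N : ℕ) (η : Frame) (x y : S2)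

theorem dY_jacksonKernel (k : Fin 2) :
    dY η (jacksonKernel N) k x y =
      (derivative (jacksonPoly (N / 2 + 1))).eval (inner ℝ (x : E3) (y : E3)) *
        inner ℝ (x : E3) (η y k : E3) := by
  simp only [dY, jacksonKernel_eq, X_eval_inner]

theorem dXdY_jacksonKernel (i k : Fin 2) :
    dXdY η (jacksonKernel N) i k x y =
      (derivative (derivative (jacksonPoly (N / 2 + 1)))).eval (inner ℝ (x : E3) (y : E3)) *
        inner ℝ (y : E3) (η x i : E3) * inner ℝ (x : E3) (η y k : E3) +
      (derivative (jacksonPoly (N / 2 + 1))).eval (inner ℝ (x : E3) (y : E3)) *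
        inner ℝ (η y k : E3) (η x i : E3) := by
  simp only [dXdY, jacksonKernel_eq, X_eval_inner, real_inner_comm (y : E3) (_ : E3),
    real_inner_comm (η y k : E3) (_ : E3)]
  rw [X_eval_inner_mul]

theorem dXdX_jacksonKernel (i k : Fin 2) :
    dXdX η (jacksonKernel N) i k x y =
      (derivative (derivative (jacksonPoly (N / 2 + 1)))).eval (inner ℝ (x : E3) (y : E3)) *
        inner ℝ (y : E3) (η x i : E3) * inner ℝ (y : E3) (η x k : E3) -
      (if i = k then 1 else 0) *
        ((derivative (jacksonPoly (N / 2 + 1))).eval (inner ℝ (x : E3) (y : E3)) *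
          inner ℝ (x : E3) (y : E3)) := by
  have h : ∀ x' : S2, inner ℝ (x' : E3) (y : E3) = inner ℝ (y : E3) (x' : E3) :=
    fun x' => real_inner_comm _ _
  simp only [dXdX, jacksonKernel_eq, h, XX_eval_inner]

theorem dXdXdY_jacksonKernel (j i k : Fin 2) :
    dXdXdY η (jacksonKernel N) j i k x y =
      (derivative (derivative (derivative (jacksonPoly (N / 2 + 1))))).eval
          (inner ℝ (x : E3) (y : E3)) *
        inner ℝ (y : E3) (η x j : E3) * inner ℝ (y : E3) (η x i : E3) *
        inner ℝ (x : E3) (η y k : E3) +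
      (derivative (derivative (jacksonPoly (N / 2 + 1)))).eval (inner ℝ (x : E3) (y : E3)) *
        (inner ℝ (y : E3) (η x j : E3) * inner ℝ (η y k : E3) (η x i : E3) +
          inner ℝ (y : E3) (η x i : E3) * inner ℝ (η y k : E3) (η x j : E3)) -
      (if j = i then 1 else 0) *
        ((derivative (derivative (jacksonPoly (N / 2 + 1)))).eval (inner ℝ (x : E3) (y : E3)) *
          inner ℝ (x : E3) (y : E3) * inner ℝ (x : E3) (η y k : E3) +
        (derivative (jacksonPoly (N / 2 + 1))).eval (inner ℝ (x : E3) (y : E3)) *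
          inner ℝ (x : E3) (η y k : E3)) := by
  have h : ∀ x' : S2, inner ℝ (x' : E3) (y : E3) = inner ℝ (y : E3) (x' : E3) :=
    fun x' => real_inner_comm _ _
  have h' : ∀ x' : S2, inner ℝ (x' : E3) (η y k : E3) = inner ℝ (η y k : E3) (x' : E3) :=
    fun x' => real_inner_comm _ _
  simp only [dXdXdY, jacksonKernel_eq, X_eval_inner, h, h', XX_eval_inner_mul]

theorem dXdYdY_jacksonKernel_self (j i k : Fin 2) :
    dXdYdY η (jacksonKernel N) j i k x x = 0 := by
  set P := jacksonPoly (N / 2 + 1)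
  have h : ∀ x' : S2, inner ℝ (x' : E3) (x : E3) = inner ℝ (x : E3) (x' : E3) :=
    fun x' => real_inner_comm _ _
  have h' : ∀ (l : Fin 2) (x' : S2), inner ℝ (x' : E3) (η x l : E3) =
      inner ℝ (η x l : E3) (x' : E3) :=
    fun l x' => real_inner_comm _ _
  simp only [dXdYdY, jacksonKernel_eq, XX_eval_inner, h, h']
  have h2 := ((hasFDerivAt_eval_inner_mul (derivative (derivative P)) x (η x i) x).mul
    (hasFDerivAt_inner (η x k : E3) x)).sub
    ((hasFDerivAt_eval_inner_mul (derivative P) x x x).const_mul (if i = k then (1 : ℝ) else 0))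
  refine (X_comp_coe η j x h2).trans ?_
  have e : ∀ l, inner ℝ (η x l : E3) (x : E3) = 0 := fun l => by
    rw [real_inner_comm]; exact inner_base_frame η x l
  split_ifs <;> simp [e, inner_base_frame]

/-- A case of Bessel's inequality: `x` and `η_i` are orthonormal. -/
theorem inner_frame_sq_le (i : Fin 2) :
    inner ℝ (y : E3) (η x i : E3) ^ 2 ≤ 1 - inner ℝ (x : E3) (y : E3) ^ 2 := by
  have h := real_inner_self_nonneg (x := (y : E3) - inner ℝ (x : E3) (y : E3) • (x : E3) -
    inner ℝ (y : E3) (η x i : E3) • (η x i : E3))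
  have h1 := inner_base_frame η x i
  have h2 : inner ℝ (η x i : E3) (x : E3) = 0 := by rw [real_inner_comm]; exact h1
  have h3 : inner ℝ (η x i : E3) (η x i : E3) = (1 : ℝ) := by simpa using inner_frame η x i i
  have h4 : ∀ z : S2, inner ℝ (z : E3) (z : E3) = (1 : ℝ) := fun z => by simp
  simp only [inner_sub_left, inner_sub_right, real_inner_smul_left, real_inner_smul_right, h1, h2,
    h3, h4, real_inner_comm (x : E3) (y : E3), real_inner_comm (y : E3) (η x i : E3)] at h
  nlinarith

theorem abs_inner_frame_frame_le (i k : Fin 2) :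
    |inner ℝ (η y k : E3) (η x i : E3)| ≤ 1 := by
  have h : ∀ (z : S2) l, ‖(η z l : E3)‖ = 1 := fun z l => (η z).norm_eq_one l
  simpa [h] using abs_real_inner_le_norm (η y k : E3) (η x i : E3)

end KernelDerivatives

/-- The bound `θ ≤ π sin (θ / 2)` turns the factor `(1 - cos θ) ^ 2 = 4 sin (θ / 2) ^ 4` into the
fourth power of the distance. -/
theorem le_div_geoDist {m B : ℝ} (c : ℝ) (k l : ℕ) (hkl : k + l = 4) (hm : 0 < m) {x y : S2}
    (hxy : x ≠ y)
    (h : |B| * (m ^ 4 * (1 - inner ℝ (x : E3) (y : E3)) ^ 2) ≤ 4 * c * m ^ k) :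
    |B| ≤ c * Real.pi ^ 4 / (m ^ l * geoDist x y ^ 4) := by
  have h0 : 0 ≤ geoDist x y := Real.arccos_nonneg _
  have h1 : geoDist x y ≤ Real.pi := Real.arccos_le_pi _
  have hd : 0 < geoDist x y := Real.arccos_pos.2 (inner_lt_one hxy)
  have h2 := Real.cos_le_one_sub_mul_cos_sq (abs_le.2 ⟨by linarith [Real.pi_pos], h1⟩)
  rw [cos_geoDist] at h2
  have h3 : 2 / Real.pi ^ 2 * geoDist x y ^ 2 ≤ 1 - inner ℝ (x : E3) (y : E3) := by linarith
  have h4 := pow_le_pow_left₀ (by positivity) h3 2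
  have h5 : |B| * (m ^ 4 * (2 / Real.pi ^ 2 * geoDist x y ^ 2) ^ 2) ≤ 4 * c * m ^ k :=
    le_trans (by gcongr) h
  have hpi := Real.pi_pos
  rw [le_div_iff₀ (by positivity)]
  rw [← hkl, pow_add] at h5
  have h6 : |B| * (m ^ k * m ^ l * (2 / Real.pi ^ 2 * geoDist x y ^ 2) ^ 2) =
      4 * m ^ k * (|B| * (m ^ l * geoDist x y ^ 4)) / Real.pi ^ 4 := by
    field_simp
    ring
  rw [h6, div_le_iff₀ (by positivity)] at h5
  refine le_of_mul_le_mul_left (a := 4 * m ^ k) ?_ (by positivity)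
  linarith

/-! ### Bounds off the diagonal -/

section OffDiagonal

variable (n : ℕ) (η : Frame) {x y : S2}

/-- The sine of the distance dominates the inner products with the frames. -/
theorem exists_sine (x y : S2) : ∃ q : ℝ, 0 ≤ q ∧ q ^ 2 = 1 - inner ℝ (x : E3) (y : E3) ^ 2 ∧
    (∀ i, |inner ℝ (y : E3) (η x i : E3)| ≤ q) ∧ ∀ k, |inner ℝ (x : E3) (η y k : E3)| ≤ q := by
  have hp := abs_le.1 (abs_inner_le_one x y)
  have h0 : 0 ≤ 1 - inner ℝ (x : E3) (y : E3) ^ 2 := by nlinarith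
  refine ⟨√(1 - inner ℝ (x : E3) (y : E3) ^ 2), Real.sqrt_nonneg _, Real.sq_sqrt h0,
    fun i => Real.abs_le_sqrt (inner_frame_sq_le η x y i), fun k => Real.abs_le_sqrt ?_⟩
  rw [real_inner_comm (y : E3)]
  exact inner_frame_sq_le η y x k

variable {N : ℕ}

theorem abs_jacksonKernel_le (hxy : x ≠ y) :
    |jacksonKernel N x y| ≤
      Real.pi ^ 4 / ((((N / 2 : ℕ) : ℝ) + 1) ^ 4 * geoDist x y ^ 4) := by
  rw [← one_mul (Real.pi ^ 4), jacksonKernel_eq]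
  refine le_div_geoDist 1 0 4 rfl (by positivity) hxy ?_
  simpa using abs_eval_jacksonPoly_le (N / 2) (abs_inner_le_one x y)

theorem abs_dY_jacksonKernel_le (hxy : x ≠ y) (k : Fin 2) :
    |dY η (jacksonKernel N) k x y| ≤
      3 * Real.pi ^ 4 / ((((N / 2 : ℕ) : ℝ) + 1) ^ 3 * geoDist x y ^ 4) := by
  obtain ⟨q, hq, hpq, -, hc⟩ := exists_sine η x y
  refine le_div_geoDist 3 1 3 rfl (by positivity) hxy ?_
  have h := abs_mul_eval_derivative_jacksonPoly_le (N / 2) hq hpq (inner_lt_one hxy)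
  rw [dY_jacksonKernel, mul_comm (eval _ _)]
  refine le_trans (mul_le_mul_of_nonneg_right ?_ (by positivity)) (h.trans_eq (by ring))
  rw [abs_mul, abs_mul q, abs_of_nonneg hq]
  exact mul_le_mul_of_nonneg_right (hc k) (abs_nonneg _)

theorem abs_dXdY_jacksonKernel_le (hxy : x ≠ y) (i k : Fin 2) :
    |dXdY η (jacksonKernel N) i k x y| ≤
      16.5 * Real.pi ^ 4 / ((((N / 2 : ℕ) : ℝ) + 1) ^ 2 * geoDist x y ^ 4) := by
  obtain ⟨q, hq, hpq, ha, hc⟩ := exists_sine η x y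
  refine le_div_geoDist 16.5 2 2 rfl (by positivity) hxy ?_
  have h1 := abs_eval_derivative_jacksonPoly_le (N / 2) hq hpq (inner_lt_one hxy)
  have h2 := abs_sq_mul_eval_derivative2_jacksonPoly_le (N / 2) hq hpq (inner_lt_one hxy)
  rw [dXdY_jacksonKernel]
  generalize hD : ((((N / 2 : ℕ) : ℝ) + 1) ^ 4 * (1 - inner ℝ (x : E3) (y : E3)) ^ 2) = D at *
  have hD0 : 0 ≤ D := by rw [← hD]; positivity
  rw [abs_mul, abs_of_nonneg (sq_nonneg q)] at h2
  have b1 := abs_mul_le_mul (le_refl _) (abs_mul_le_mul (ha i) (hc k))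
    (a := eval (inner ℝ (x : E3) (y : E3)) (derivative (derivative (jacksonPoly (N / 2 + 1)))))
  have b2 := abs_mul_le_mul (le_refl _) (abs_inner_frame_frame_le η x y i k)
    (a := eval (inner ℝ (x : E3) (y : E3)) (derivative (jacksonPoly (N / 2 + 1))))
  rw [mul_assoc]
  refine le_trans (mul_le_mul_of_nonneg_right ((abs_add_le _ _).trans (add_le_add b1 b2)) hD0) ?_
  nlinarith [sq_nonneg (((N / 2 : ℕ) : ℝ) + 1)]

theorem abs_dXdX_jacksonKernel_le (hxy : x ≠ y) (i k : Fin 2) :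
    |dXdX η (jacksonKernel N) i k x y| ≤
      16.5 * Real.pi ^ 4 / ((((N / 2 : ℕ) : ℝ) + 1) ^ 2 * geoDist x y ^ 4) := by
  obtain ⟨q, hq, hpq, ha, hc⟩ := exists_sine η x y
  refine le_div_geoDist 16.5 2 2 rfl (by positivity) hxy ?_
  have h1 := abs_eval_derivative_jacksonPoly_le (N / 2) hq hpq (inner_lt_one hxy)
  have h2 := abs_sq_mul_eval_derivative2_jacksonPoly_le (N / 2) hq hpq (inner_lt_one hxy)
  rw [dXdX_jacksonKernel]
  generalize hD : ((((N / 2 : ℕ) : ℝ) + 1) ^ 4 * (1 - inner ℝ (x : E3) (y : E3)) ^ 2) = D at *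
  have hD0 : 0 ≤ D := by rw [← hD]; positivity
  rw [abs_mul, abs_of_nonneg (sq_nonneg q)] at h2
  have hδ : |if i = k then (1 : ℝ) else 0| ≤ 1 := by split_ifs <;> simp
  have b1 := abs_mul_le_mul (le_refl _) (abs_mul_le_mul (ha i) (ha k))
    (a := eval (inner ℝ (x : E3) (y : E3)) (derivative (derivative (jacksonPoly (N / 2 + 1)))))
  have b2 := abs_mul_le_mul hδ (abs_mul_le_mul (le_refl _) (abs_inner_le_one x y)
    (a := eval (inner ℝ (x : E3) (y : E3)) (derivative (jacksonPoly (N / 2 + 1)))))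
  rw [mul_assoc]
  refine le_trans (mul_le_mul_of_nonneg_right ((abs_sub _ _).trans (add_le_add b1 b2)) hD0) ?_
  nlinarith [sq_nonneg (((N / 2 : ℕ) : ℝ) + 1)]

theorem abs_dXdXdY_jacksonKernel_le (hxy : x ≠ y) (j i k : Fin 2) :
    |dXdXdY η (jacksonKernel N) j i k x y| ≤
      101 * Real.pi ^ 4 / ((((N / 2 : ℕ) : ℝ) + 1) * geoDist x y ^ 4) := by
  obtain ⟨q, hq, hpq, ha, hc⟩ := exists_sine η x y
  rw [← pow_one (((N / 2 : ℕ) : ℝ) + 1)]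
  refine le_div_geoDist 101 3 1 rfl (by positivity) hxy ?_
  have h1 := abs_mul_eval_derivative_jacksonPoly_le (N / 2) hq hpq (inner_lt_one hxy)
  have h2 := abs_mul_eval_derivative2_jacksonPoly_le (N / 2) hq hpq (inner_lt_one hxy)
  have h3 := abs_cube_mul_eval_derivative3_jacksonPoly_le (N / 2) hq hpq (inner_lt_one hxy)
  rw [dXdXdY_jacksonKernel]
  generalize hD : ((((N / 2 : ℕ) : ℝ) + 1) ^ 4 * (1 - inner ℝ (x : E3) (y : E3)) ^ 2) = D at *
  have hD0 : 0 ≤ D := by rw [← hD]; positivity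
  have hp := abs_inner_le_one x y
  have hδ : |if j = i then (1 : ℝ) else 0| ≤ 1 := by split_ifs <;> simp
  generalize hP1 : eval (inner ℝ (x : E3) (y : E3)) (derivative (jacksonPoly (N / 2 + 1))) = P1 at *
  generalize hP2 : eval (inner ℝ (x : E3) (y : E3))
    (derivative (derivative (jacksonPoly (N / 2 + 1)))) = P2 at *
  generalize hP3 : eval (inner ℝ (x : E3) (y : E3))
    (derivative (derivative (derivative (jacksonPoly (N / 2 + 1))))) = P3 at *
  rw [abs_mul, abs_of_nonneg hq] at h1 h2
  rw [abs_mul, abs_of_nonneg (pow_nonneg hq 3)] at h3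
  have b1 := abs_mul_le_mul (abs_mul_le_mul (abs_mul_le_mul (le_refl |P3|) (ha j)) (ha i)) (hc k)
  have b2 := abs_mul_le_mul (le_refl |P2|) ((abs_add_le _ _).trans
    (add_le_add (abs_mul_le_mul (ha j) (abs_inner_frame_frame_le η x y i k))
      (abs_mul_le_mul (ha i) (abs_inner_frame_frame_le η x y j k))))
  have b3 := abs_mul_le_mul hδ ((abs_add_le _ _).trans
    (add_le_add (abs_mul_le_mul (abs_mul_le_mul (le_refl |P2|) hp) (hc k))
      (abs_mul_le_mul (le_refl |P1|) (hc k))))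
  refine le_trans (mul_le_mul_of_nonneg_right ((abs_sub _ _).trans
    (add_le_add ((abs_add_le _ _).trans (add_le_add b1 b2)) b3)) hD0) ?_
  -- the total is `268 + 3 * 26 + 12 ≤ 4 * 101`
  have hm : (((N / 2 : ℕ) : ℝ) + 1) ≤ (((N / 2 : ℕ) : ℝ) + 1) ^ 3 :=
    le_self_pow₀ (by simp) (by norm_num)
  have hm0 : 0 ≤ (((N / 2 : ℕ) : ℝ) + 1) ^ 3 := by positivity
  linarith

end OffDiagonal

end Kernel

end SphereJackson

end

theorem mainTheorem5 (N n : ℕ) (hn : n = N / 2) (η : SphereJackson.Frame) :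
    -- `J̃_N` is smooth and the kernel is smooth in normal coordinates, so that all
    -- derivatives below exist
    ContDiff ℝ ∞ (SphereJackson.jacksonTrig N) ∧
    (∀ x y : SphereJackson.S2, ContDiff ℝ ∞
      (fun p : SphereJackson.TangentPlane x × SphereJackson.TangentPlane y =>
        SphereJackson.jacksonKernel N (SphereJackson.sphereExp x p.1)
          (SphereJackson.sphereExp y p.2))) ∧
    -- bounds off the diagonal
    (∀ x y : SphereJackson.S2, x ≠ y →
      |SphereJackson.jacksonKernel N x y| ≤
        Real.pi ^ 4 / (((n : ℝ) + 1) ^ 4 * SphereJackson.geoDist x y ^ 4) ∧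
      (∀ k : Fin 2, |SphereJackson.dY η (SphereJackson.jacksonKernel N) k x y| ≤
        3 * Real.pi ^ 4 / (((n : ℝ) + 1) ^ 3 * SphereJackson.geoDist x y ^ 4)) ∧
      (∀ i k : Fin 2, |SphereJackson.dXdY η (SphereJackson.jacksonKernel N) i k x y| ≤
        16.5 * Real.pi ^ 4 / (((n : ℝ) + 1) ^ 2 * SphereJackson.geoDist x y ^ 4)) ∧
      (∀ i k : Fin 2, |SphereJackson.dXdX η (SphereJackson.jacksonKernel N) i k x y| ≤
        16.5 * Real.pi ^ 4 / (((n : ℝ) + 1) ^ 2 * SphereJackson.geoDist x y ^ 4)) ∧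
      (∀ j i k : Fin 2, |SphereJackson.dXdXdY η (SphereJackson.jacksonKernel N) j i k x y| ≤
        101 * Real.pi ^ 4 / (((n : ℝ) + 1) * SphereJackson.geoDist x y ^ 4))) ∧
    -- values on the diagonal
    (∀ x : SphereJackson.S2,
      SphereJackson.jacksonKernel N x x = 1 ∧
      (∀ i : Fin 2, SphereJackson.dXdY η (SphereJackson.jacksonKernel N) i i x x =
        -iteratedDeriv 2 (SphereJackson.jacksonTrig N) 0) ∧
      (∀ i : Fin 2, SphereJackson.dXdX η (SphereJackson.jacksonKernel N) i i x x =
        iteratedDeriv 2 (SphereJackson.jacksonTrig N) 0) ∧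
      (∀ k : Fin 2, SphereJackson.dY η (SphereJackson.jacksonKernel N) k x x = 0) ∧
      (∀ i k : Fin 2, i ≠ k → SphereJackson.dXdY η (SphereJackson.jacksonKernel N) i k x x = 0) ∧
      (∀ i k : Fin 2, i ≠ k → SphereJackson.dXdX η (SphereJackson.jacksonKernel N) i k x x = 0) ∧
      (∀ j i k : Fin 2,
        SphereJackson.dXdXdY η (SphereJackson.jacksonKernel N) j i k x x = 0) ∧
      (∀ j i k : Fin 2,
        SphereJackson.dXdYdY η (SphereJackson.jacksonKernel N) j i k x x = 0)) := by
  subst hn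
  have hP : (SphereJackson.jacksonPoly (N / 2 + 1)).eval 1 = 1 :=
    SphereJackson.eval_jacksonPoly_one (by omega)
  have h11 : ∀ x : SphereJackson.S2, inner ℝ (x : SphereJackson.E3) (x : SphereJackson.E3) =
      (1 : ℝ) := fun x => by simp
  refine ⟨SphereJackson.contDiff_jacksonTrig N, SphereJackson.contDiff_jacksonKernel_sphereExp N,
    fun x y hxy => ⟨SphereJackson.abs_jacksonKernel_le hxy,
      SphereJackson.abs_dY_jacksonKernel_le η hxy, SphereJackson.abs_dXdY_jacksonKernel_le η hxy,
      SphereJackson.abs_dXdX_jacksonKernel_le η hxy,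
      SphereJackson.abs_dXdXdY_jacksonKernel_le η hxy⟩,
    fun x => ⟨?_, fun i => ?_, fun i => ?_, fun k => ?_, fun i k hik => ?_, fun i k hik => ?_,
      fun j i k => ?_, SphereJackson.dXdYdY_jacksonKernel_self N η x⟩⟩
  · rw [SphereJackson.jacksonKernel_eq, h11, hP]
  · rw [SphereJackson.dXdY_jacksonKernel, SphereJackson.iteratedDeriv_two_jacksonTrig_zero, h11,
      SphereJackson.inner_base_frame, SphereJackson.inner_frame]
    simp
  · rw [SphereJackson.dXdX_jacksonKernel, SphereJackson.iteratedDeriv_two_jacksonTrig_zero, h11,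
      SphereJackson.inner_base_frame]
    simp
  · rw [SphereJackson.dY_jacksonKernel, SphereJackson.inner_base_frame, mul_zero]
  · rw [SphereJackson.dXdY_jacksonKernel, SphereJackson.inner_base_frame,
      SphereJackson.inner_frame, if_neg hik.symm]
    simp
  · rw [SphereJackson.dXdX_jacksonKernel, SphereJackson.inner_base_frame, if_neg hik]
    simp
  · rw [SphereJackson.dXdXdY_jacksonKernel]
    simp only [SphereJackson.inner_base_frame]
    simp
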